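/- For positive integers $q, N$ write $[N]=\{0,\dots,N-1\}$, and for a non-negative integer $X$ let $X[i]$ be its digit at position $i$ in base $q$ (position $0$ is the lower-order end, and $X[i]=0$ beyond the leading digit). In the \emph{cell-probe model} with $w$ bits per cell, the memory consists of cells that hold $w$-bit words and are addressed by $w$-bit words. An online algorithm receives one input per time step $t=0,1,2,\dots$; in step $t$ it makes an adaptive sequence of reads and writes of cells, which depends only on $t$, the input of that step and the values read during that step, and then outputs a value. Nothing but the memory is kept from one step to the next, computation is free, and the running time is the total number of cell reads and writes. Algorithms are deterministic, and their program and initial memory may depend on all the parameters of the problem. \textbf{Theorem.} There is an absolute constant $c>0$ such that for all positive integers $\delta$, $n$ and $w$, with $q=2^\delta$, the following hold in the cell-probe model with $w$ bits per cell. (1) Consider an algorithm that solves the online multiplication problem: for all $X,Y\in[q^n]$, if the pair $(X[i],Y[i])$ arrives at step $i$, then the digit $(XY)[i]$ is output at step $i$, for every $i<n$. Its expected running time over the steps $0,\dots,n-1$, for $X$ and $Y$ independent and uniformly random in $[q^n]$, is at least $c\,\frac{\delta}{w}\,n\log n$. (2) The same bound holds even if the algorithm has full access to every digit of $Y$: for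 every $Y\in[q^n]$ let there be given an algorithm, depending arbitrarily on $Y$, which for every $X\in[q^n]$ outputs $(XY)[i]$ at step $i$ for every $i<n$ when only $X[i]$ arrives at step $i$. Then the expected running time, for $X$ and $Y$ independent and uniformly random in $[q^n]$, is at least $c\,\frac{\delta}{w}\,n\log n$. (3) The same bound holds when $Y=K_{q,n}$ is fixed and only $X$ is uniformly random in $[q^n]$, for every algorithm (which may depend on $Y$) that outputs $(XK_{q,n})[i]$ at step $i$ for all $X\in[q^n]$ and $i<n$ when $X[i]$ arrives at step $i$. Here $K_{q,n}\in[q^n]$ is the number whose binary bit $i$, for $0\le i<\delta n$, is $1$ if and only if $i$ is a power of two. -/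

import Mathlib

open scoped BigOperators

namespace CellProbe

/-- A memory cell holds a word of `w` bits. -/
abbrev Word (w : ℕ) : Type := Fin w → Bool

/-- The memory: cells are addressed by `w`-bit words (a cell can hold the address of any cell),
and each cell contains a `w`-bit word. -/
abbrev Memory (w : ℕ) : Type := Word w → Word w

/-- The computation carried out during one operation, producing a value in `Out`: an adaptive
sequence of cell probes (reads and writes) followed by an output.  The next probe may depend
arbitrarily on everything read so far in this operation. -/
inductive Program (w : ℕ) (Out : Type) : Type where
  | output (z : Out) : Program w Out
  | read (a : Word w) (next : Word w → Program w Out) : Program w Out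
  | write (a v : Word w) (next : Program w Out) : Program w Out

namespace Program

variable {w : ℕ} {Out : Type}

/-- The value output by a program started on memory `m`. -/
def result : Program w Out → Memory w → Out
  | output z, _ => z
  | read a next, m => result (next (m a)) m
  | write a v next, m => result next (Function.update m a v)

/-- The memory left behind by a program started on memory `m`. -/
def memory : Program w Out → Memory w → Memory w
  | output _, m => m
  | read a next, m => memory (next (m a)) m
  | write a v next, m => memory next (Function.update m a v)

/-- The number of cell probes (reads and writes) made by a program started on memory `m`. -/
def probes : Program w Out → Memory w → ℕ
  | output _, _ => 0
  | read a next, m => probes (next (m a)) m + 1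
  | write a v next, m => probes next (Function.update m a v) + 1

end Program

/-- A (deterministic, possibly non-uniform) online algorithm in the cell-probe model with `w` bits
per cell.  At each time `t` one element of `In` arrives, and a program depending on `t` and on this
element only is executed; nothing but the memory is carried over from one time to the next. -/
structure Algorithm (w : ℕ) (In Out : Type) : Type where
  init : Memory w
  step : ℕ → In → Program w Out

namespace Algorithm

variable {w : ℕ} {In Out : Type}

/-- The memory just before the arrival of the input of time `t`. -/
def memoryAt (A : Algorithm w In Out) (inp : ℕ → In) : ℕ → Memory w
  | 0 => A.init
  | t + 1 => (A.step t (inp t)).memory (A.memoryAt inp t)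

/-- The output at time `t`. -/
def outputAt (A : Algorithm w In Out) (inp : ℕ → In) (t : ℕ) : Out :=
  (A.step t (inp t)).result (A.memoryAt inp t)

/-- The running time over the times `0, …, n - 1`: the total number of cell probes. -/
def time (A : Algorithm w In Out) (inp : ℕ → In) (n : ℕ) : ℕ :=
  ∑ t ∈ Finset.range n, (A.step t (inp t)).probes (A.memoryAt inp t)

end Algorithm

/-- The digit of `X` at position `i` in base `q`; position `0` is the lower-order end. -/
def digit (q : ℕ) [NeZero q] (X i : ℕ) : Fin q := Fin.ofNat q (X / q ^ i)

/-- The digits of `X` in base `q`, arriving one at a time. -/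
def digits (q : ℕ) [NeZero q] (X : ℕ) : ℕ → Fin q := fun t => digit q X t

/-- The digits of `X` and `Y` in base `q`, arriving one pair at a time. -/
def digitPairs (q : ℕ) [NeZero q] (X Y : ℕ) : ℕ → Fin q × Fin q :=
  fun t => (digit q X t, digit q Y t)

/-- `A` solves the online multiplication problem on two `n`-digit numbers in base `q`: for all
`X, Y ∈ [q ^ n]`, it outputs the `i`-th digit of `X * Y` when the `i`-th pair of digits arrives. -/
def SolvesMul (q n : ℕ) [NeZero q] {w : ℕ} (A : Algorithm w (Fin q × Fin q) (Fin q)) : Prop :=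
  ∀ X Y : Fin (q ^ n), ∀ i < n, A.outputAt (digitPairs q X Y) i = digit q (X * Y : ℕ) i

/-- `A` solves the online multiplication problem for the fixed multiplier `Y`: only the digits of
`X` arrive online, while `A` itself may depend on `Y`. -/
def SolvesMulBy (q n Y : ℕ) [NeZero q] {w : ℕ} (A : Algorithm w (Fin q) (Fin q)) : Prop :=
  ∀ X : Fin (q ^ n), ∀ i < n, A.outputAt (digits q X) i = digit q (X * Y : ℕ) i

open Classical in
/-- The number `K_{q,n}` for `q = 2 ^ δ`: it has `δ * n` bits, and its `i`-th bit is `1` if and only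
if `i` is a power of two. -/
noncomputable def K (δ n : ℕ) : ℕ :=
  Nat.ofBits (fun i : Fin (δ * n) => decide (∃ k : ℕ, (i : ℕ) = 2 ^ k))

end CellProbe

/-! The bound is an information-transfer argument. Split a dyadic interval of times into halves of
length `l`, put `L = δ * l`, and fix the digits of `X` outside the left half. The outputs in the
right half are then the bits `[L, 2L)` of `x * y + B`, where `x` is the left-half block of `X` and
`B` is fixed. If this window always leaves at most `2 ^ (L - ⌈L/8⌉)` candidates for `x` (`Spreads`),
it reveals about `L / 8` bits of `x`. They can reach the right half only through cells last written
in the left half and read in the right half. Address and content of such a cell cost at most `3 * w`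
bits, so for at least half of all `X` the number of these cells has order `L / w`
(`two_mul_card_small_transfer_le`).

A read is charged to at most one dyadic node, so the running time dominates the sum over all nodes
(`sum_card_nodeTransfer_le`). Each of the roughly `log n` levels contributes order `δ * n / w`.

For `Spreads` it suffices that small multiples of some `2 ^ a * y` avoid a neighbourhood of `0`
modulo `4 ^ L` (`card_window_le`). A union bound gives this for at least a quarter of all
multipliers (`card_spreads_ge`); the sparse binary expansion of `K` gives it at every scale
(`spreads_K`). -/

namespace CellProbe

/-! ### Windows of products and multiples close to zero -/

/-- The window of `L` bits, starting at bit `L`, of `x * y + B` determines `x < 2 ^ L` up to few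
possibilities. -/
def Spreads (L y : ℕ) : Prop :=
  ∀ B z : ℕ, ((Finset.range (2 ^ L)).filter
    (fun x => (x * y + B) / 2 ^ L % 2 ^ L = z)).card ≤ 2 ^ (L - (L + 7) / 8)

/-- If adding `D` keeps the upper half of the residue modulo `M * M`, that residue moves by less
than `M`, and the move is congruent to `D`. -/
theorem mod_sq_of_div_mod_eq {M S D : ℕ} (hM : 0 < M)
    (h : (S + D) / M % M = S / M % M) :
    D % (M * M) < M ∨ M * M - M < D % (M * M) := by
  have h1 : S % (M * M) = S % M + M * (S / M % M) := Nat.mod_mul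
  have h2 : (S + D) % (M * M) = (S + D) % M + M * ((S + D) / M % M) := Nat.mod_mul
  have h3 : (S + D) % (M * M) = (S % (M * M) + D % (M * M)) % (M * M) := Nat.add_mod _ _ _
  rw [h] at h2
  have ha := Nat.mod_lt S hM
  have hb := Nat.mod_lt (S + D) hM
  have hMM : 0 < M * M := Nat.mul_pos hM hM
  have hc := Nat.mod_lt S hMM
  have hd := Nat.mod_lt D hMM
  have he := Nat.mod_lt (S + D) hMM
  have hMM' : M ≤ M * M := Nat.le_mul_of_pos_left M hM
  generalize M * (S / M % M) = u at *
  generalize M * M = Q at *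
  rcases lt_or_ge (S % Q + D % Q) Q with hlt | hge
  · rw [Nat.mod_eq_of_lt hlt] at h3
    omega
  · have h4 : (S % Q + D % Q) % Q = S % Q + D % Q - Q := by
      rw [Nat.mod_eq_sub_mod hge, Nat.mod_eq_of_lt (by omega)]
    rw [h4] at h3
    omega

/-- Two numbers with the same lowest `a` bits and the same bits from `a + r` on differ by `d * 2 ^
a` with `d < 2 ^ r`; by `mod_sq_of_div_mod_eq` their windows differ unless `d = 0`. So within a
fibre the other `L - r` bits identify `x`. -/
theorem card_window_le {L y a r : ℕ} (har : a + r ≤ L)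
    (h : ∀ d, 0 < d → d < 2 ^ r → 2 ^ L ≤ d * 2 ^ a * y % (2 ^ L * 2 ^ L) ∧
      d * 2 ^ a * y % (2 ^ L * 2 ^ L) ≤ 2 ^ L * 2 ^ L - 2 ^ L) (B z : ℕ) :
    ((Finset.range (2 ^ L)).filter
      (fun x => (x * y + B) / 2 ^ L % 2 ^ L = z)).card ≤ 2 ^ (L - r) := by
  have hcard : (Finset.range (2 ^ (L - a - r)) ×ˢ Finset.range (2 ^ a)).card = 2 ^ (L - r) := by
    rw [Finset.card_product, Finset.card_range, Finset.card_range, ← pow_add]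
    congr 1
    omega
  rw [← hcard]
  have key : ∀ x x' : ℕ, x' < x → x / 2 ^ (a + r) = x' / 2 ^ (a + r) → x % 2 ^ a = x' % 2 ^ a →
      (x * y + B) / 2 ^ L % 2 ^ L ≠ (x' * y + B) / 2 ^ L % 2 ^ L := by
    intro x x' hlt h1 h2 h3
    have hx := Nat.div_add_mod x (2 ^ a)
    have hx' := Nat.div_add_mod x' (2 ^ a)
    have hA : 0 < 2 ^ a := by positivity
    have hR : 0 < 2 ^ r := by positivity
    rw [pow_add, ← Nat.div_div_eq_div_mul, ← Nat.div_div_eq_div_mul] at h1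
    have hu := Nat.div_add_mod (x / 2 ^ a) (2 ^ r)
    have hu' := Nat.div_add_mod (x' / 2 ^ a) (2 ^ r)
    have hl := Nat.mod_lt (x / 2 ^ a) hR
    have hl' := Nat.mod_lt (x' / 2 ^ a) hR
    rw [h1] at hu
    rw [h2] at hx
    have hdlt : x' / 2 ^ a < x / 2 ^ a := by
      by_contra hcon
      have := Nat.mul_le_mul_left (2 ^ a) (not_lt.mp hcon)
      omega
    obtain ⟨d, hd⟩ := Nat.exists_eq_add_of_lt hdlt
    have hxd : x = x' + (d + 1) * 2 ^ a := by
      rw [← hx, hd]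
      conv_rhs => rw [← hx']
      ring
    have hS : x * y + B = (x' * y + B) + (d + 1) * 2 ^ a * y := by
      rw [hxd]; ring
    rw [hS] at h3
    have := mod_sq_of_div_mod_eq (by positivity) h3
    have := h (d + 1) (by omega) (by omega)
    omega
  apply Finset.card_le_card_of_injOn (fun x => (x / 2 ^ (a + r), x % 2 ^ a))
  · intro x hx
    simp only [Finset.coe_filter, Finset.mem_range, Set.mem_ofPred_eq] at hx
    simp only [Finset.coe_product, Finset.coe_range, Set.mem_prod, Set.mem_Iio]
    refine ⟨?_, Nat.mod_lt _ (by positivity)⟩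
    rw [Nat.div_lt_iff_lt_mul (by positivity), ← pow_add]
    have : L - a - r + (a + r) = L := by omega
    rw [this]
    exact hx.1
  · intro x hx x' hx' heq
    simp only [Finset.coe_filter, Finset.mem_range, Set.mem_ofPred_eq] at hx hx'
    simp only [Prod.mk.injEq] at heq
    rcases lt_trichotomy x x' with hlt | heq' | hlt
    · exact absurd (hx'.2.trans hx.2.symm) (key x' x hlt heq.1.symm heq.2.symm)
    · exact heq'
    · exact absurd (hx.2.trans hx'.2.symm) (key x x' hlt heq.1 heq.2)

theorem spreads_of_forall {L y a r : ℕ} (har : a + r ≤ L) (hr : (L + 7) / 8 ≤ r)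
    (h : ∀ d, 0 < d → d < 2 ^ r → 2 ^ L ≤ d * 2 ^ a * y % (2 ^ L * 2 ^ L) ∧
      d * 2 ^ a * y % (2 ^ L * 2 ^ L) ≤ 2 ^ L * 2 ^ L - 2 ^ L) : Spreads L y := by
  intro B z
  exact (card_window_le har h B z).trans (Nat.pow_le_pow_right (by norm_num) (by omega))

/-! ### Random multipliers -/

/-- The residue `d * y % M` and the quotient `d * y / M < d` together determine `y`. -/
theorem card_mul_mod_mem_le {M d : ℕ} (hM : 0 < M) (hd : 0 < d) (T : Finset ℕ) :
    ((Finset.range M).filter (fun y => d * y % M ∈ T)).card ≤ d * T.card := by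
  have : (Finset.range d ×ˢ T).card = d * T.card := by simp
  rw [← this]
  apply Finset.card_le_card_of_injOn (fun y => (d * y / M, d * y % M))
  · intro y hy
    simp only [Finset.coe_filter, Finset.mem_range, Set.mem_ofPred_eq] at hy
    simp only [Finset.coe_product, Finset.coe_range, Set.mem_prod, Set.mem_Iio, Finset.mem_coe]
    refine ⟨?_, hy.2⟩
    rw [Nat.div_lt_iff_lt_mul hM]
    exact Nat.mul_lt_mul_of_pos_left hy.1 hd
  · intro y _ y' _ heq
    simp only [Prod.mk.injEq] at heq
    have h1 := Nat.div_add_mod (d * y) M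
    have h2 := Nat.div_add_mod (d * y') M
    rw [heq.1, heq.2, h2] at h1
    exact (Nat.eq_of_mul_eq_mul_left hd h1).symm

/-- The first two factors are the sum of all `d < 2 ^ r` with `r = (L + 7) / 8`; the third counts
the residues near `0`. At `L = 1` there is equality, so the subtracted ones are needed. -/
theorem union_bound_arith {L : ℕ} (hL : 0 < L) :
    4 * (2 ^ ((L + 7) / 8 - 1) * (2 ^ ((L + 7) / 8) - 1) * (2 * 2 ^ L - 1)) ≤
      3 * (2 ^ L * 2 ^ L) := by
  rcases le_or_gt L 8 with h8 | h8
  · have : (L + 7) / 8 = 1 := by omega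
    rw [this]
    have h2 : 2 ≤ 2 ^ L := by
      calc 2 = 2 ^ 1 := by norm_num
        _ ≤ 2 ^ L := Nat.pow_le_pow_right (by norm_num) hL
    generalize 2 ^ L = M at *
    obtain ⟨k, rfl⟩ := Nat.exists_eq_add_of_le h2
    have : 2 * (2 + k) - 1 = 2 * k + 3 := by omega
    rw [this]
    norm_num
    nlinarith
  · set r := (L + 7) / 8 with hr
    have h1 : 2 ^ (r - 1) * (2 ^ r - 1) * (2 * 2 ^ L - 1) ≤ 2 ^ (r - 1) * 2 ^ r * (2 * 2 ^ L) := by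
      exact Nat.mul_le_mul (Nat.mul_le_mul_left _ (Nat.sub_le _ _)) (Nat.sub_le _ _)
    have h2 : 4 * (2 ^ (r - 1) * 2 ^ r * (2 * 2 ^ L)) = 2 ^ (2 + (r - 1) + r + 1 + L) := by
      rw [pow_add, pow_add, pow_add, pow_add]; ring
    have h3 : 2 ^ (2 + (r - 1) + r + 1 + L) ≤ 2 ^ (L + L) :=
      Nat.pow_le_pow_right (by norm_num) (by omega)
    rw [pow_add 2 L L] at h3
    omega

open Classical in
/-- The multipliers modulo `4 ^ L` that have a small multiple close to `0` modulo `4 ^ L`. -/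
noncomputable def collidingMultipliers (L : ℕ) : Finset ℕ :=
  (Finset.range (2 ^ L * 2 ^ L)).filter
    (fun y => ∃ d ∈ Finset.Ico 1 (2 ^ ((L + 7) / 8)),
      ¬ (2 ^ L ≤ d * y % (2 ^ L * 2 ^ L) ∧ d * y % (2 ^ L * 2 ^ L) ≤ 2 ^ L * 2 ^ L - 2 ^ L))

theorem card_collidingMultipliers_le {L : ℕ} (hL : 0 < L) :
    4 * (collidingMultipliers L).card ≤ 3 * (2 ^ L * 2 ^ L) := by
  unfold collidingMultipliers
  set r := (L + 7) / 8 with hr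
  set M := 2 ^ L with hMdef
  have hM : 0 < M := by positivity
  have hMM : M ≤ M * M := Nat.le_mul_of_pos_left M hM
  -- The residues at cyclic distance less than `M` from `0`: `M` at the bottom and `M - 1` at the
  -- top.
  set T : Finset ℕ := Finset.range M ∪ Finset.Ico (M * M - M + 1) (M * M) with hT
  have hTc : T.card ≤ 2 * M - 1 := by
    refine (Finset.card_union_le _ _).trans ?_
    rw [Finset.card_range, Nat.card_Ico]
    omega
  refine le_trans ?_ (union_bound_arith hL)
  rw [← hr, ← hMdef]
  refine Nat.mul_le_mul_left 4 ?_
  calc _ ≤ ((Finset.Ico 1 (2 ^ r)).biUnion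
        (fun d => (Finset.range (M * M)).filter (fun y => d * y % (M * M) ∈ T))).card := by
        apply Finset.card_le_card
        intro y hy
        simp only [Finset.mem_filter, Finset.mem_range] at hy
        obtain ⟨hy, d, hd, hbad⟩ := hy
        simp only [Finset.mem_biUnion, Finset.mem_filter, Finset.mem_range]
        refine ⟨d, hd, hy, ?_⟩
        have := Nat.mod_lt (d * y) (Nat.mul_pos hM hM)
        simp only [hT, Finset.mem_union, Finset.mem_range, Finset.mem_Ico]
        omega
    _ ≤ ∑ d ∈ Finset.Ico 1 (2 ^ r), d * (2 * M - 1) := by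
        refine Finset.card_biUnion_le.trans (Finset.sum_le_sum fun d hd => ?_)
        rw [Finset.mem_Ico] at hd
        exact (card_mul_mod_mem_le (Nat.mul_pos hM hM) hd.1 T).trans
          (Nat.mul_le_mul_left d hTc)
    _ = _ := by
        rw [← Finset.sum_mul]
        congr 1
        have h1 : ∑ d ∈ Finset.Ico 1 (2 ^ r), d = ∑ d ∈ Finset.range (2 ^ r), d := by
          rw [Finset.range_eq_Ico, Finset.sum_eq_sum_Ico_succ_bot (a := 0) (Nat.two_pow_pos r)]
          simp
        rw [h1]
        have h2 := Finset.sum_range_id_mul_two (2 ^ r)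
        have h3 : 2 ^ r = 2 * 2 ^ (r - 1) := by
          rw [← pow_succ']; congr 1; omega
        have h4 : 2 ^ r * (2 ^ r - 1) = 2 * (2 ^ (r - 1) * (2 ^ r - 1)) := by
          rw [← mul_assoc, ← h3]
        omega

/-- A multiplier that does not spread reduces modulo `4 ^ L` to one of the colliding multipliers,
and each residue has `2 ^ (m - 2L)` lifts. -/
theorem card_spreads_ge {L m : ℕ} [DecidablePred (Spreads L)] (hL : 0 < L) (hm : L + L ≤ m) :
    2 ^ m ≤ 4 * ((Finset.univ : Finset (Fin (2 ^ m))).filter (fun y : Fin (2 ^ m) => Spreads L y)).card := by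
  set Q := 2 ^ L * 2 ^ L with hQ
  have hQ0 : 0 < Q := by positivity
  set bad := collidingMultipliers L with hbad
  have h1 : 4 * bad.card ≤ 3 * Q := card_collidingMultipliers_le hL
  have hmQ : 2 ^ m = Q * 2 ^ (m - (L + L)) := by
    rw [hQ, ← pow_add, ← pow_add]; congr 1; omega
  have h2 : ((Finset.univ : Finset (Fin (2 ^ m))).filter (fun y : Fin (2 ^ m) => ¬ Spreads L y)).card ≤
      bad.card * 2 ^ (m - (L + L)) := by
    have : (bad ×ˢ Finset.range (2 ^ (m - (L + L)))).card = bad.card * 2 ^ (m - (L + L)) := by simp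
    rw [← this]
    apply Finset.card_le_card_of_injOn (fun y : Fin (2 ^ m) => ((y : ℕ) % Q, (y : ℕ) / Q))
    · intro y hy
      simp only [Finset.coe_filter, Finset.mem_univ, true_and, Set.mem_ofPred_eq] at hy
      simp only [Finset.coe_product, Finset.coe_range, Set.mem_prod, Set.mem_Iio, Finset.mem_coe]
      constructor
      · simp only [hbad, collidingMultipliers, Finset.mem_filter, Finset.mem_range, ← hQ]
        refine ⟨Nat.mod_lt _ hQ0, ?_⟩
        by_contra hcon
        push Not at hcon
        refine hy (spreads_of_forall (a := 0) (r := (L + 7) / 8) (by omega) le_rfl ?_)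
        intro d hd hd'
        have := hcon d (Finset.mem_Ico.mpr ⟨hd, hd'⟩)
        simpa [Nat.mul_mod, hQ] using this
      · rw [Nat.div_lt_iff_lt_mul hQ0, mul_comm, ← hmQ]
        exact y.2
    · intro y _ y' _ heq
      simp only [Prod.mk.injEq] at heq
      apply Fin.ext
      rw [← Nat.div_add_mod (y : ℕ) Q, heq.1, heq.2, Nat.div_add_mod]
  have h3 := Finset.card_filter_add_card_filter_not
    (s := (Finset.univ : Finset (Fin (2 ^ m)))) (fun y : Fin (2 ^ m) => Spreads L y)
  rw [Finset.card_univ, Fintype.card_fin] at h3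
  have h4 : 4 * (bad.card * 2 ^ (m - (L + L))) ≤ 3 * 2 ^ m := by
    rw [hmQ, ← mul_assoc, ← mul_assoc]
    exact Nat.mul_le_mul_right _ h1
  omega

/-! ### The fixed multiplier -/

theorem testBit_K (δ n i : ℕ) :
    (K δ n).testBit i = true ↔ i < δ * n ∧ ∃ k : ℕ, i = 2 ^ k := by
  unfold K
  rw [Nat.testBit_ofBits]
  split_ifs with h <;> simp [h]

/-- `2 ^ p` is the largest power of two below `2L`, hence the top bit position of the residue; the
next one is `2 ^ p / 2`. For `p = 0` that quotient is `0`, which is not a power of two, whence the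
proviso `0 < p`. -/
theorem K_mod_two_pow {δ n L p : ℕ} (hn : L + L ≤ δ * n) (h1 : L ≤ 2 ^ p) (h2 : 2 ^ p < L + L)
    (h3 : L + L ≤ 2 ^ (p + 1)) :
    2 ^ 2 ^ p ≤ K δ n % (2 ^ L * 2 ^ L) ∧
    K δ n % (2 ^ L * 2 ^ L) < 2 ^ 2 ^ p + 2 ^ (2 ^ p / 2 + 1) ∧
    (0 < p → 2 ^ (2 ^ p / 2) ≤ K δ n % 2 ^ 2 ^ p ∧ K δ n % 2 ^ 2 ^ p < 2 ^ (2 ^ p / 2 + 1)) := by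
  rw [← pow_add]
  have hlow : K δ n % 2 ^ 2 ^ p < 2 ^ (2 ^ p / 2 + 1) := by
    apply Nat.lt_pow_two_of_testBit
    intro i hi
    rw [Nat.testBit_mod_two_pow]
    by_contra hcon
    simp only [Bool.and_eq_false_imp, decide_eq_true_eq, not_forall, Bool.not_eq_false] at hcon
    obtain ⟨hlt, hbit⟩ := hcon
    obtain ⟨_, k, rfl⟩ := (testBit_K δ n i).mp hbit
    have hk : k < p := (Nat.pow_lt_pow_iff_right (by norm_num)).mp hlt
    obtain ⟨p', rfl⟩ : ∃ p', p = p' + 1 := ⟨p - 1, by omega⟩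
    have : 2 ^ k ≤ 2 ^ p' := Nat.pow_le_pow_right (by norm_num) (by omega)
    rw [pow_succ] at hi
    omega
  have hbitp : (K δ n % 2 ^ (L + L)).testBit (2 ^ p) = true := by
    rw [Nat.testBit_mod_two_pow]
    simp only [Bool.and_eq_true, decide_eq_true_eq]
    exact ⟨h2, (testBit_K δ n _).mpr ⟨by omega, p, rfl⟩⟩
  have htop : K δ n % 2 ^ (L + L) < 2 ^ (2 ^ p + 1) := by
    apply Nat.lt_pow_two_of_testBit
    intro i hi
    rw [Nat.testBit_mod_two_pow]
    by_contra hcon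
    simp only [Bool.and_eq_false_imp, decide_eq_true_eq, not_forall, Bool.not_eq_false] at hcon
    obtain ⟨hlt, hbit⟩ := hcon
    obtain ⟨_, k, rfl⟩ := (testBit_K δ n i).mp hbit
    have h4 : k < p + 1 := (Nat.pow_lt_pow_iff_right (by norm_num : 1 < 2)).mp (by omega)
    have : 2 ^ k ≤ 2 ^ p := Nat.pow_le_pow_right (by norm_num) (by omega)
    omega
  have hge := Nat.ge_two_pow_of_testBit hbitp
  refine ⟨hge, ?_, fun hp => ⟨?_, hlow⟩⟩
  · have hmm : K δ n % 2 ^ (L + L) % 2 ^ 2 ^ p = K δ n % 2 ^ 2 ^ p :=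
      Nat.mod_mod_of_dvd _ (Nat.pow_dvd_pow 2 h2.le)
    rw [Nat.mod_eq_sub_mod hge, Nat.mod_eq_of_lt (by rw [pow_succ] at htop; omega)] at hmm
    omega
  · apply Nat.ge_two_pow_of_testBit
    obtain ⟨p', rfl⟩ : ∃ p', p = p' + 1 := ⟨p - 1, by omega⟩
    have h5 : 2 ^ (p' + 1) / 2 = 2 ^ p' := by rw [pow_succ]; omega
    have h6 : 0 < 2 ^ p' := by positivity
    rw [Nat.testBit_mod_two_pow, h5]
    simp only [Bool.and_eq_true, decide_eq_true_eq]
    rw [pow_succ] at h2 ⊢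
    exact ⟨by omega, (testBit_K δ n _).mpr ⟨by omega, p', rfl⟩⟩

/-- Let `P` be the largest power of two below `2L`. If at least `⌈L/8⌉` positions lie between `P`
and `2L`, small multiples of the residue stay above `2 ^ P` without wrapping around. Otherwise a
shift by `2L - P` pushes bit `P` out of the residue, and bit `P / 2`, with ample room above it,
takes over. -/
theorem spreads_K {δ n L : ℕ} (hL : 0 < L) (hn : L + L ≤ δ * n) : Spreads L (K δ n) := by
  obtain ⟨p, h1, h2, h3⟩ : ∃ p, L ≤ 2 ^ p ∧ 2 ^ p < L + L ∧ L + L ≤ 2 ^ (p + 1) := by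
    refine ⟨Nat.log 2 (L + L - 1), ?_⟩
    have ha := Nat.lt_pow_succ_log_self (b := 2) (by norm_num) (L + L - 1)
    have hb := Nat.pow_log_le_self 2 (x := L + L - 1) (by omega)
    rw [Nat.succ_eq_add_one, pow_succ] at ha
    rw [pow_succ]
    omega
  obtain ⟨hge, hlt, hlow⟩ := K_mod_two_pow hn h1 h2 h3
  set P := 2 ^ p with hP
  set y := K δ n with hy
  set Q := 2 ^ L * 2 ^ L with hQ
  have hQpow : Q = 2 ^ (L + L) := by rw [hQ, pow_add]
  rcases Nat.eq_zero_or_pos p with hp | hp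
  -- Here `L = 1`, and the residue modulo `4` is exactly `2`.
  · have hP1 : P = 1 := by rw [hP, hp]; rfl
    have hL1 : L = 1 := by omega
    subst hL1
    refine spreads_of_forall (a := 0) (r := 1) (by norm_num) (by norm_num) ?_
    intro d hd hd'
    have : d = 1 := by omega
    subst this
    rw [hP1] at hge hlt
    have hQ4 : Q = 4 := by rw [hQ]; norm_num
    have hodd : y % 2 = 0 := by
      by_contra hcon
      have : y.testBit 0 = true := by rw [Nat.testBit_zero]; simp; omega
      obtain ⟨_, k, hk⟩ := (testBit_K δ n 0).mp this
      exact absurd hk.symm (by positivity)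
    rw [hQ4] at hge hlt
    norm_num at hge hlt ⊢
    omega
  obtain ⟨hlow1, hlow2⟩ := hlow hp
  have hPeven : P = 2 * (P / 2) := by
    obtain ⟨p', rfl⟩ : ∃ p', p = p' + 1 := ⟨p - 1, by omega⟩
    rw [hP, pow_succ]; omega
  have hPpos : 0 < P := by positivity
  have hLP : 2 ^ L ≤ 2 ^ P := Nat.pow_le_pow_right (by norm_num) h1
  by_cases hcase : (L + 7) / 8 ≤ L + L - P - 1
  · refine spreads_of_forall (a := 0) (r := L + L - P - 1) (by omega) hcase ?_
    intro d hd hd'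
    have hmod : d * 2 ^ 0 * y % Q = d * (y % Q) % Q := by
      rw [pow_zero, mul_one, Nat.mul_mod_mod]
    have hlow' : 2 ^ P ≤ d * (y % Q) := hge.trans (Nat.le_mul_of_pos_left _ hd)
    have hup : d * (y % Q) + 2 ^ P ≤ Q := by
      have e1 : d * (y % Q) ≤ d * (2 ^ P + 2 ^ (P / 2 + 1)) := Nat.mul_le_mul_left d hlt.le
      have e2 : (d + 1) * 2 ^ P ≤ 2 ^ (L + L - P - 1) * 2 ^ P := Nat.mul_le_mul_right _ hd'
      have e3 : d * 2 ^ (P / 2 + 1) ≤ 2 ^ (L + L - P - 1) * 2 ^ (P / 2 + 1) :=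
        Nat.mul_le_mul_right _ hd'.le
      have e4 : 2 ^ (L + L - P - 1) * 2 ^ P = 2 ^ (L + L - 1) := by
        rw [← pow_add]; congr 1; omega
      have e5 : 2 ^ (L + L - P - 1) * 2 ^ (P / 2 + 1) ≤ 2 ^ (L + L - 1) := by
        rw [← pow_add]; exact Nat.pow_le_pow_right (by norm_num) (by omega)
      have e6 : Q = 2 * 2 ^ (L + L - 1) := by
        rw [hQpow, ← pow_succ']; congr 1; omega
      rw [mul_add] at e1
      rw [add_mul] at e2
      omega
    have hmod2 : d * (y % Q) % Q = d * (y % Q) := Nat.mod_eq_of_lt (by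
      have : 0 < 2 ^ P := by positivity
      omega)
    rw [hmod, hmod2]
    omega
  -- `P / 2 - 2` keeps the multiples at most `Q / 2`, and `P - L` ensures `a + r ≤ L`. This case
  -- forces `L ≥ 9`, hence `P ≥ 16`, so the subtraction does not truncate.
  · set r := min (P / 2 - 2) (P - L) with hr
    refine spreads_of_forall (a := L + L - P) (r := r) (by omega) (by omega) ?_
    intro d hd hd'
    have hmod : d * 2 ^ (L + L - P) * y % Q = d * 2 ^ (L + L - P) * (y % 2 ^ P) % Q := by
      have e : Q = 2 ^ (L + L - P) * 2 ^ P := by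
        rw [hQpow, ← pow_add]; congr 1; omega
      rw [mul_comm d, mul_assoc, mul_assoc, e, Nat.mul_mod_mul_left, Nat.mul_mod_mul_left,
        Nat.mul_mod_mod]
    have hlow' : 2 ^ L ≤ d * 2 ^ (L + L - P) * (y % 2 ^ P) := by
      calc 2 ^ L ≤ 2 ^ (L + L - P + P / 2) := Nat.pow_le_pow_right (by norm_num) (by omega)
        _ = 1 * 2 ^ (L + L - P) * 2 ^ (P / 2) := by rw [pow_add, one_mul]
        _ ≤ _ := by gcongr; omega
    have hup : d * 2 ^ (L + L - P) * (y % 2 ^ P) ≤ 2 ^ (L + L - 1) := by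
      calc d * 2 ^ (L + L - P) * (y % 2 ^ P)
          ≤ 2 ^ r * 2 ^ (L + L - P) * 2 ^ (P / 2 + 1) := by gcongr
        _ = 2 ^ (r + (L + L - P) + (P / 2 + 1)) := by rw [← pow_add, ← pow_add]
        _ ≤ _ := Nat.pow_le_pow_right (by norm_num) (by omega)
    have e6 : Q = 2 * 2 ^ (L + L - 1) := by
      rw [hQpow, ← pow_succ']; congr 1; omega
    have e7 : 2 ^ L ≤ 2 ^ (L + L - 1) := Nat.pow_le_pow_right (by norm_num) (by omega)
    have e8 : 0 < 2 ^ (L + L - 1) := by positivity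
    rw [hmod, Nat.mod_eq_of_lt (by omega)]
    omega

end CellProbe

/-! ### Information transfer between intervals of time -/

namespace CellProbe

namespace Program

variable {w : ℕ} {Out : Type}

/-- The time of the last write to each cell, after a program that is run at time `t`. -/
def stamps : Program w Out → Memory w → (Word w → ℕ) → ℕ → (Word w → ℕ)
  | output _, _, s, _ => s
  | read a next, m, s, t => stamps (next (m a)) m s t
  | write a v next, m, s, t => stamps next (Function.update m a v) (Function.update s a t) t

/-- The reads made by a program that is run at time `t`: the address of the cell, together with the
time at which this cell was last written. -/
def trace : Program w Out → Memory w → (Word w → ℕ) → ℕ → List (Word w × ℕ)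
  | output _, _, _, _ => []
  | read a next, m, s, t => (a, s a) :: trace (next (m a)) m s t
  | write a v next, m, s, t => trace next (Function.update m a v) (Function.update s a t) t

theorem length_trace_le (p : Program w Out) (m : Memory w) (s : Word w → ℕ) (t : ℕ) :
    (p.trace m s t).length ≤ p.probes m := by
  induction p generalizing m s with
  | output z => simp [trace]
  | read a next ih => simpa [trace, probes] using ih (m a) m s
  | write a v next ih =>
    simp only [trace, probes]
    exact (ih _ _).trans (Nat.le_succ _)

theorem unchanged_or_stamps_eq (p : Program w Out) (m : Memory w) (s : Word w → ℕ) (t : ℕ)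
    (a : Word w) :
    (p.memory m a = m a ∧ p.stamps m s t a = s a) ∨ p.stamps m s t a = t := by
  induction p generalizing m s with
  | output z => exact Or.inl ⟨rfl, rfl⟩
  | read b next ih => exact ih (m b) m s
  | write b v next ih =>
    simp only [memory, stamps]
    rcases eq_or_ne a b with rfl | hab
    · rcases ih (Function.update m a v) (Function.update s a t) with h | h
      · right; rw [h.2]; simp
      · exact Or.inr h
    · simpa [hab] using ih (Function.update m b v) (Function.update s b t)

/-- Two memories with time stamps agree on all cells that are in `S` or last written outside
the set `I` of times in both of them. -/
def Agree (I : Set ℕ) (S : Finset (Word w)) (m m' : Memory w) (s s' : Word w → ℕ) : Prop :=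
  ∀ a, (s a ∈ I → a ∈ S) → (s' a ∈ I → a ∈ S) → m a = m' a

/-- While all values read coincide, both runs make the same probes. A write makes its cell coincide
in both memories, so only reads need control by `S`. -/
theorem Agree.run {I : Set ℕ} {S : Finset (Word w)} {t : ℕ} (p : Program w Out)
    {m m' : Memory w} {s s' : Word w → ℕ} (h : Agree I S m m' s s')
    (hS : ∀ x ∈ p.trace m s t, x.2 ∈ I → x.1 ∈ S)
    (hS' : ∀ x ∈ p.trace m' s' t, x.2 ∈ I → x.1 ∈ S) :
    p.result m = p.result m' ∧
      Agree I S (p.memory m) (p.memory m') (p.stamps m s t) (p.stamps m' s' t) := by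
  induction p generalizing m m' s s' with
  | output z => exact ⟨rfl, h⟩
  | read a next ih =>
    simp only [trace, List.mem_cons, forall_eq_or_imp] at hS hS'
    have hma : m a = m' a := h a hS.1 hS'.1
    simp only [result, memory, stamps]
    rw [← hma] at hS' ⊢
    exact ih (m a) h hS.2 hS'.2
  | write a v next ih =>
    simp only [trace] at hS hS'
    simp only [result, memory, stamps]
    refine ih ?_ hS hS'
    intro b hb hb'
    rcases eq_or_ne b a with rfl | hba
    · simp
    · simp only [Function.update_of_ne hba] at hb hb' ⊢
      exact h b hb hb'

end Program

namespace Algorithm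

variable {w : ℕ} {In Out : Type}

/-- The time of the last write to each cell, just before time `t`. -/
def stampAt (A : Algorithm w In Out) (inp : ℕ → In) : ℕ → (Word w → ℕ)
  -- A cell never written is stamped `0`. This can only enlarge the transfer sets, and each read
  -- still carries a single stamp.
  | 0 => fun _ => 0
  | t + 1 => (A.step t (inp t)).stamps (A.memoryAt inp t) (A.stampAt inp t) t

/-- The reads at time `t`, with the times of the last writes. -/
def traceAt (A : Algorithm w In Out) (inp : ℕ → In) (t : ℕ) : List (Word w × ℕ) :=
  (A.step t (inp t)).trace (A.memoryAt inp t) (A.stampAt inp t) t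

/-- The cells that transfer information from the times in `[t₀, t₁)` to the times in `[t₁, t₂)`. -/
def transfer (A : Algorithm w In Out) (inp : ℕ → In) (t₀ t₁ t₂ : ℕ) : Finset (Word w) :=
  (Finset.Ico t₁ t₂).biUnion fun t =>
    (((A.traceAt inp t).filter (fun x => t₀ ≤ x.2 ∧ x.2 < t₁)).map Prod.fst).toFinset

theorem mem_transfer {A : Algorithm w In Out} {inp : ℕ → In} {t₀ t₁ t₂ t : ℕ} (h₁ : t₁ ≤ t)
    (h₂ : t < t₂) {x : Word w × ℕ} (hx : x ∈ A.traceAt inp t) (hI : x.2 ∈ Set.Ico t₀ t₁) :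
    x.1 ∈ A.transfer inp t₀ t₁ t₂ := by
  simp only [transfer, Finset.mem_biUnion, Finset.mem_Ico, List.mem_toFinset, List.mem_map,
    List.mem_filter, decide_eq_true_eq]
  exact ⟨t, ⟨h₁, h₂⟩, x, ⟨hx, hI.1, hI.2⟩, rfl⟩

theorem card_transfer_le (A : Algorithm w In Out) (inp : ℕ → In) (t₀ t₁ t₂ : ℕ) :
    (A.transfer inp t₀ t₁ t₂).card ≤
      ∑ t ∈ Finset.Ico t₁ t₂, (A.traceAt inp t).countP (fun x => t₀ ≤ x.2 ∧ x.2 < t₁) := by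
  refine Finset.card_biUnion_le.trans (Finset.sum_le_sum fun t _ => ?_)
  refine (List.toFinset_card_le _).trans ?_
  rw [List.length_map, List.countP_eq_length_filter]

theorem memoryAt_congr (A : Algorithm w In Out) {inp inp' : ℕ → In} {t₀ : ℕ}
    (h : ∀ t < t₀, inp t = inp' t) : A.memoryAt inp t₀ = A.memoryAt inp' t₀ := by
  induction t₀ with
  | zero => rfl
  | succ t ih =>
    simp only [memoryAt]
    rw [ih fun s hs => h s (by omega), h t (by omega)]

theorem memoryAt_eq_or_stampAt (A : Algorithm w In Out) (inp : ℕ → In) {t₀ t₁ : ℕ} (h : t₀ ≤ t₁)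
    (a : Word w) :
    A.memoryAt inp t₁ a = A.memoryAt inp t₀ a ∨ A.stampAt inp t₁ a ∈ Set.Ico t₀ t₁ := by
  induction t₁, h using Nat.le_induction with
  | base => exact Or.inl rfl
  | succ t ht ih =>
    simp only [memoryAt, stampAt, Set.mem_Ico] at ih ⊢
    rcases (A.step t (inp t)).unchanged_or_stamps_eq (A.memoryAt inp t) (A.stampAt inp t) t a with
      ⟨h1, h2⟩ | h1
    · rw [h1, h2]
      exact ih.imp id fun h => ⟨h.1, by omega⟩
    · right; omega

/-- The outputs at the times in `[t₁, t₂)` depend on the inputs at the times in `[t₀, t₁)` only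
through the contents of the cells that transfer information. -/
theorem outputAt_eq_of_transfer_eq (A : Algorithm w In Out) {inp inp' : ℕ → In} {t₀ t₁ t₂ : ℕ}
    (h01 : t₀ ≤ t₁) (hpre : ∀ t < t₀, inp t = inp' t)
    (hpost : ∀ t, t₁ ≤ t → t < t₂ → inp t = inp' t)
    (hS : A.transfer inp t₀ t₁ t₂ = A.transfer inp' t₀ t₁ t₂)
    (hval : ∀ a ∈ A.transfer inp t₀ t₁ t₂, A.memoryAt inp t₁ a = A.memoryAt inp' t₁ a)
    {t : ℕ} (h1 : t₁ ≤ t) (h2 : t < t₂) : A.outputAt inp t = A.outputAt inp' t := by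
  set S := A.transfer inp t₀ t₁ t₂ with hSdef
  have step : ∀ u, t₁ ≤ u → u < t₂ →
      Program.Agree (Set.Ico t₀ t₁) S (A.memoryAt inp u) (A.memoryAt inp' u) (A.stampAt inp u)
        (A.stampAt inp' u) →
      A.outputAt inp u = A.outputAt inp' u ∧
      Program.Agree (Set.Ico t₀ t₁) S (A.memoryAt inp (u + 1)) (A.memoryAt inp' (u + 1))
        (A.stampAt inp (u + 1)) (A.stampAt inp' (u + 1)) := by
    intro u hu hu' hag
    simp only [outputAt, memoryAt, stampAt]
    have e := hpost u hu hu'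
    rw [← e]
    refine hag.run _ ?_ ?_
    · exact fun x hx hI => mem_transfer hu hu' hx hI
    · rw [e]
      intro x hx hI
      rw [hS]
      exact mem_transfer hu hu' hx hI
  have hag : ∀ u, t₁ ≤ u → u ≤ t₂ →
      Program.Agree (Set.Ico t₀ t₁) S (A.memoryAt inp u) (A.memoryAt inp' u) (A.stampAt inp u)
        (A.stampAt inp' u) := by
    intro u hu
    induction u, hu using Nat.le_induction with
    | base =>
      intro _ a ha ha'
      by_cases haS : a ∈ S
      · exact hval a haS
      -- A cell outside `S` that is stamped outside `[t₀, t₁)` in both runs is unchanged since `t₀`,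
      -- when the two memories were equal.
      · have e1 := (A.memoryAt_eq_or_stampAt inp h01 a).resolve_right fun h => haS (ha h)
        have e2 := (A.memoryAt_eq_or_stampAt inp' h01 a).resolve_right fun h => haS (ha' h)
        rw [e1, e2, A.memoryAt_congr hpre]
    | succ u hu ih => exact fun hu' => (step u hu (by omega) (ih (by omega))).2
  exact (step t h1 h2 (hag t h1 h2.le)).1

/-- The addresses and contents of the cells that transfer information. -/
def transferGraph (A : Algorithm w In Out) (inp : ℕ → In) (t₀ t₁ t₂ : ℕ) :
    Finset (Word w × Word w) :=
  (A.transfer inp t₀ t₁ t₂).image fun a => (a, A.memoryAt inp t₁ a)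

theorem card_transferGraph (A : Algorithm w In Out) (inp : ℕ → In) (t₀ t₁ t₂ : ℕ) :
    (A.transferGraph inp t₀ t₁ t₂).card = (A.transfer inp t₀ t₁ t₂).card :=
  Finset.card_image_of_injective _ fun _ _ h => (Prod.mk.inj h).1

theorem mem_transferGraph {A : Algorithm w In Out} {inp : ℕ → In} {t₀ t₁ t₂ : ℕ} {a v : Word w} :
    (a, v) ∈ A.transferGraph inp t₀ t₁ t₂ ↔
      a ∈ A.transfer inp t₀ t₁ t₂ ∧ A.memoryAt inp t₁ a = v := by
  simp only [transferGraph, Finset.mem_image, Prod.mk.injEq]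
  constructor
  · rintro ⟨b, hb, rfl, rfl⟩
    exact ⟨hb, rfl⟩
  · rintro ⟨h, rfl⟩
    exact ⟨a, h, rfl, rfl⟩

theorem outputAt_eq_of_transferGraph_eq (A : Algorithm w In Out) {inp inp' : ℕ → In}
    {t₀ t₁ t₂ : ℕ} (h01 : t₀ ≤ t₁) (hpre : ∀ t < t₀, inp t = inp' t)
    (hpost : ∀ t, t₁ ≤ t → t < t₂ → inp t = inp' t)
    (hG : A.transferGraph inp t₀ t₁ t₂ = A.transferGraph inp' t₀ t₁ t₂)
    {t : ℕ} (h1 : t₁ ≤ t) (h2 : t < t₂) : A.outputAt inp t = A.outputAt inp' t := by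
  have key : ∀ a ∈ A.transfer inp t₀ t₁ t₂, a ∈ A.transfer inp' t₀ t₁ t₂ ∧
      A.memoryAt inp' t₁ a = A.memoryAt inp t₁ a := by
    intro a ha
    exact mem_transferGraph.mp (hG ▸ mem_transferGraph.mpr ⟨ha, rfl⟩)
  refine A.outputAt_eq_of_transfer_eq h01 hpre hpost ?_ (fun a ha => (key a ha).2.symm) h1 h2
  ext a
  refine ⟨fun ha => (key a ha).1, fun ha => ?_⟩
  exact (mem_transferGraph.mp (hG ▸ mem_transferGraph.mpr ⟨ha, rfl⟩)).1

end Algorithm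

/-- Such a set is the set of values of a `k`-tuple, padded with `none`. -/
theorem card_finset_card_le {α : Type*} [Fintype α] [DecidableEq α] (k : ℕ) :
    ((Finset.univ : Finset (Finset α)).filter (fun G => G.card ≤ k)).card ≤
      (Fintype.card α + 1) ^ k := by
  have h : Fintype.card (Fin k → Option α) = (Fintype.card α + 1) ^ k := by simp
  rw [← h, ← Finset.card_univ]
  refine Finset.card_le_card_of_surjOn
    (fun g : Fin k → Option α => Finset.univ.filter (fun a => ∃ i, g i = some a)) ?_
  intro G hG
  simp only [Finset.coe_filter, Finset.mem_univ, true_and, Set.mem_ofPred_eq] at hG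
  refine ⟨fun i => G.toList[(i : ℕ)]?, by simp, ?_⟩
  ext a
  simp only [Finset.mem_filter, Finset.mem_univ, true_and]
  rw [← Finset.mem_toList, List.mem_iff_getElem?]
  constructor
  · rintro ⟨i, hi⟩
    exact ⟨i, hi⟩
  · rintro ⟨i, hi⟩
    have hlt : i < G.toList.length := (List.getElem?_eq_some_iff.mp hi).1
    rw [Finset.length_toList] at hlt
    exact ⟨⟨i, by omega⟩, hi⟩

/-- A pair takes `2 * w` bits; the third `w` absorbs the padding symbol, as `2 ^ (2 * w) + 1 ≤ 2 ^
(3 * w)` for `w > 0`. -/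
theorem card_transferGraphs_le {w : ℕ} (hw : 0 < w) (k : ℕ) :
    ((Finset.univ : Finset (Finset (Word w × Word w))).filter (fun G => G.card ≤ k)).card ≤
      2 ^ (3 * w * k) := by
  refine (card_finset_card_le k).trans ?_
  rw [pow_mul]
  apply Nat.pow_le_pow_left
  have h1 : Fintype.card (Word w × Word w) = 2 ^ w * 2 ^ w := by simp
  have h2 : 2 ≤ 2 ^ w := by
    calc 2 = 2 ^ 1 := by norm_num
      _ ≤ 2 ^ w := Nat.pow_le_pow_right (by norm_num) hw
  have h3 : 2 ^ (3 * w) = 2 ^ w * 2 ^ w * 2 ^ w := by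
    rw [← pow_add, ← pow_add]; congr 1; omega
  rw [h1, h3]
  nlinarith [Nat.mul_le_mul h2 h2, Nat.mul_le_mul_left (2 ^ w * 2 ^ w) h2]

/-! ### Summing over the dyadic tree -/

theorem sum_countP_le_length {ι α : Type*} (V : Finset ι) (P : ι → α → Prop)
    [∀ v, DecidablePred (P v)]
    (hP : ∀ x, ∀ v ∈ V, ∀ v' ∈ V, P v x → P v' x → v = v') (l : List α) :
    ∑ v ∈ V, l.countP (fun x => P v x) ≤ l.length := by
  induction l with
  | nil => simp
  | cons x l ih =>
    simp only [List.countP_cons, List.length_cons, Finset.sum_add_distrib, decide_eq_true_eq]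
    have : ∑ v ∈ V, (if P v x then 1 else 0) ≤ 1 := by
      rw [← Finset.card_filter, Finset.card_le_one]
      intro v hv v' hv'
      rw [Finset.mem_filter] at hv hv'
      exact hP x v hv.1 v' hv'.1 hv.2 hv'.2
    omega

/-- The node is the lowest common ancestor of `s` and `t`: at every higher level both lie in the
same block. -/
theorem dyadic_unique {j k j' k' s t : ℕ} (h1 : s / 2 ^ j = 2 * k) (h2 : t / 2 ^ j = 2 * k + 1)
    (h1' : s / 2 ^ j' = 2 * k') (h2' : t / 2 ^ j' = 2 * k' + 1) : j = j' ∧ k = k' := by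
  have key : ∀ {j k j' k' : ℕ}, s / 2 ^ j = 2 * k → t / 2 ^ j = 2 * k + 1 →
      s / 2 ^ j' = 2 * k' → t / 2 ^ j' = 2 * k' + 1 → ¬ j < j' := by
    intro j k j' k' h1 h2 h1' h2' hlt
    obtain ⟨e, rfl⟩ := Nat.exists_eq_add_of_lt hlt
    have e1 : 2 ^ (j + e + 1) = 2 ^ j * (2 * 2 ^ e) := by ring
    rw [e1, ← Nat.div_div_eq_div_mul, ← Nat.div_div_eq_div_mul] at h1' h2'
    rw [h1] at h1'
    rw [h2] at h2'
    have e2 : 2 * k / 2 = k := by omega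
    have e3 : (2 * k + 1) / 2 = k := by omega
    rw [e2] at h1'
    rw [e3] at h2'
    omega
  have hj : j = j' := le_antisymm (not_lt.mp (key h1' h2' h1 h2)) (not_lt.mp (key h1 h2 h1' h2'))
  subst hj
  exact ⟨rfl, by omega⟩

/-- The inner nodes of the dyadic tree on `[0, n)`: `⟨j, k⟩` stands for the interval of length
`2 ^ (j + 1)` that starts at `k * 2 ^ (j + 1)`. -/
def dyadicNodes (n : ℕ) : Finset (Σ _ : ℕ, ℕ) :=
  (Finset.range (Nat.log 2 n)).sigma fun j => Finset.range (n / 2 ^ (j + 1))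

theorem dyadicNodes_bound {n : ℕ} {v : Σ _ : ℕ, ℕ} (hv : v ∈ dyadicNodes n) :
    2 * v.2 * 2 ^ v.1 + 2 * 2 ^ v.1 ≤ n := by
  simp only [dyadicNodes, Finset.mem_sigma, Finset.mem_range] at hv
  have := (Nat.le_div_iff_mul_le (by positivity)).mp (Nat.succ_le_of_lt hv.2)
  rw [pow_succ] at this
  calc _ = (v.2 + 1) * (2 ^ v.1 * 2) := by ring
    _ ≤ n := this

/-- The cells that transfer information from the left to the right half of a dyadic node. -/
def Algorithm.nodeTransfer {w : ℕ} {In Out : Type} (A : Algorithm w In Out) (inp : ℕ → In)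
    (v : Σ _ : ℕ, ℕ) : Finset (Word w) :=
  A.transfer inp (2 * v.2 * 2 ^ v.1) (2 * v.2 * 2 ^ v.1 + 2 ^ v.1)
    (2 * v.2 * 2 ^ v.1 + 2 * 2 ^ v.1)

theorem div_two_pow_eq {s j m : ℕ} (h1 : m * 2 ^ j ≤ s) (h2 : s < m * 2 ^ j + 2 ^ j) :
    s / 2 ^ j = m :=
  Nat.div_eq_of_lt_le h1 (by rw [Nat.succ_mul]; exact h2)

/-- Each read counts at most once, at the node that separates its time from the time of the last
write. -/
theorem Algorithm.sum_card_nodeTransfer_le {w : ℕ} {In Out : Type} (A : Algorithm w In Out)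
    (inp : ℕ → In) (n : ℕ) :
    ∑ v ∈ dyadicNodes n, (A.nodeTransfer inp v).card ≤ A.time inp n := by
  calc ∑ v ∈ dyadicNodes n, (A.nodeTransfer inp v).card
      ≤ ∑ v ∈ dyadicNodes n, ∑ t ∈ Finset.range n, (A.traceAt inp t).countP
          (fun x => x.2 / 2 ^ v.1 = 2 * v.2 ∧ t / 2 ^ v.1 = 2 * v.2 + 1) := by
        refine Finset.sum_le_sum fun v hv => (A.card_transfer_le inp _ _ _).trans ?_
        have hb := dyadicNodes_bound hv
        refine (Finset.sum_le_sum fun t ht => ?_).trans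
          (Finset.sum_le_sum_of_subset (s := Finset.Ico _ _) ?_)
        · rw [Finset.mem_Ico] at ht
          apply List.countP_mono_left
          intro x _ hx
          simp only [decide_eq_true_eq] at hx ⊢
          refine ⟨div_two_pow_eq hx.1 hx.2, div_two_pow_eq ?_ ?_⟩
          · rw [add_mul, one_mul]; exact ht.1
          · rw [add_mul, one_mul]; omega
        · intro t ht
          rw [Finset.mem_Ico] at ht
          exact Finset.mem_range.mpr (by omega)
    _ = ∑ t ∈ Finset.range n, ∑ v ∈ dyadicNodes n, (A.traceAt inp t).countP
          (fun x => x.2 / 2 ^ v.1 = 2 * v.2 ∧ t / 2 ^ v.1 = 2 * v.2 + 1) := Finset.sum_comm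
    _ ≤ ∑ t ∈ Finset.range n, (A.traceAt inp t).length := by
        refine Finset.sum_le_sum fun t _ => ?_
        refine sum_countP_le_length (dyadicNodes n)
          (fun v (x : Word w × ℕ) => x.2 / 2 ^ v.1 = 2 * v.2 ∧ t / 2 ^ v.1 = 2 * v.2 + 1) ?_ _
        rintro x ⟨j, k⟩ _ ⟨j', k'⟩ _ h h'
        obtain ⟨rfl, rfl⟩ := dyadic_unique h.1 h.2 h'.1 h'.2
        rfl
    _ ≤ A.time inp n := Finset.sum_le_sum fun t _ => Program.length_trace_le _ _ _ _

end CellProbe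

/-! ### The lower bound at one node -/

namespace CellProbe

section Digits

theorem eq_low_add_mid_add_high (q X s l : ℕ) :
    X = X % q ^ s + q ^ s * (X / q ^ s % q ^ l + q ^ l * (X / q ^ (s + l))) := by
  rw [pow_add, ← Nat.div_div_eq_div_mul, Nat.mod_add_div, Nat.mod_add_div]

variable {q : ℕ} [NeZero q]

theorem val_digit (X i : ℕ) : (digit q X i : ℕ) = X / q ^ i % q := rfl

theorem digit_eq_of_mod_eq {X X' s t : ℕ} (h : X % q ^ s = X' % q ^ s) (ht : t < s) :
    digit q X t = digit q X' t := by
  apply Fin.ext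
  rw [val_digit, val_digit, ← Nat.mod_mul_right_div_self, ← Nat.mod_mul_right_div_self, ← pow_succ,
    ← Nat.mod_mod_of_dvd X (Nat.pow_dvd_pow q (Nat.succ_le_of_lt ht)), h,
    Nat.mod_mod_of_dvd X' (Nat.pow_dvd_pow q (Nat.succ_le_of_lt ht))]

theorem digit_eq_of_div_eq {X X' s t : ℕ} (h : X / q ^ s = X' / q ^ s) (ht : s ≤ t) :
    digit q X t = digit q X' t := by
  apply Fin.ext
  obtain ⟨e, rfl⟩ := Nat.exists_eq_add_of_le ht
  rw [val_digit, val_digit, pow_add, ← Nat.div_div_eq_div_mul, ← Nat.div_div_eq_div_mul, h]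

theorem div_mod_eq_of_digit_eq {U V s l : ℕ}
    (h : ∀ i < l, digit q U (s + i) = digit q V (s + i)) :
    U / q ^ s % q ^ l = V / q ^ s % q ^ l := by
  induction l with
  | zero => simp [Nat.mod_one]
  | succ l ih =>
    have h1 := congrArg Fin.val (h l (by omega))
    rw [val_digit, val_digit, pow_add, ← Nat.div_div_eq_div_mul, ← Nat.div_div_eq_div_mul] at h1
    rw [Nat.mod_pow_succ, Nat.mod_pow_succ, ih fun i hi => h i (by omega), h1]

/-- This brings the product into the form `x * y + B` of `Spreads`: the lower digits enter only
through a carry, and `B` depends only on the digits outside the block. -/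
theorem mul_div_pow_eq (X y s l : ℕ) :
    X * y / q ^ (s + l) =
      (X / q ^ s % q ^ l * y + (X % q ^ s * y / q ^ s + q ^ l * (X / q ^ (s + l)) * y)) /
        q ^ l := by
  have hq : 0 < q ^ s := Nat.pow_pos (NeZero.pos q)
  conv_lhs => rw [eq_low_add_mid_add_high q X s l]
  rw [pow_add, ← Nat.div_div_eq_div_mul, ← pow_add]
  congr 1
  have : (X % q ^ s + q ^ s * (X / q ^ s % q ^ l + q ^ l * (X / q ^ (s + l)))) * y =
      X % q ^ s * y + q ^ s * ((X / q ^ s % q ^ l + q ^ l * (X / q ^ (s + l))) * y) := by ring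
  rw [this, Nat.add_mul_div_left _ _ hq]
  ring

end Digits

variable {δ n w : ℕ}

theorem two_mul_card_small_transfer_le {q : ℕ} [NeZero q] (hq : q = 2 ^ δ) (hδ : 0 < δ)
    (hw : 0 < w) {y t₀ l : ℕ} (hl : 0 < l) (hn : t₀ + 2 * l ≤ n)
    {A : Algorithm w (Fin q) (Fin q)} (hA : SolvesMulBy q n y A) (hy : Spreads (δ * l) y) :
    2 * ((Finset.univ : Finset (Fin (q ^ n))).filter (fun X : Fin (q ^ n) =>
      (A.transfer (digits q X) t₀ (t₀ + l) (t₀ + 2 * l)).card ≤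
        ((δ * l + 7) / 8 - 1) / (3 * w))).card ≤ q ^ n := by
  set k := ((δ * l + 7) / 8 - 1) / (3 * w) with hk
  set L := δ * l with hL
  have hL0 : 0 < L := Nat.mul_pos hδ hl
  have hqL : q ^ l = 2 ^ L := by rw [hq, hL, pow_mul]
  have hq0 : 0 < q := NeZero.pos q
  -- The threshold `k` is chosen so that `3 * w * k ≤ ⌈L/8⌉ - 1`: graphs times blocks per graph then
  -- cover at most half of a fibre of `2 ^ L` blocks.
  have hgraph : 2 ^ (3 * w * k) * 2 ^ (L - (L + 7) / 8) ≤ 2 ^ (L - 1) := by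
    rw [← pow_add]
    apply Nat.pow_le_pow_right (by norm_num)
    have := Nat.mul_div_le ((L + 7) / 8 - 1) (3 * w)
    rw [← hk] at this
    omega
  -- The outer digits and the graph determine all outputs in the right half, hence the window, and
  -- few middle blocks share a window.
  have hsame : ∀ lo hi : ℕ, ∀ G : Finset (Word w × Word w),
      ((Finset.univ : Finset (Fin (q ^ n))).filter (fun X : Fin (q ^ n) =>
        (X : ℕ) % q ^ t₀ = lo ∧ (X : ℕ) / q ^ (t₀ + l) = hi ∧
        A.transferGraph (digits q X) t₀ (t₀ + l) (t₀ + 2 * l) = G)).card ≤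
      2 ^ (L - (L + 7) / 8) := by
    intro lo hi G
    rcases Finset.eq_empty_or_nonempty ((Finset.univ : Finset (Fin (q ^ n))).filter
      (fun X : Fin (q ^ n) => (X : ℕ) % q ^ t₀ = lo ∧ (X : ℕ) / q ^ (t₀ + l) = hi ∧
        A.transferGraph (digits q X) t₀ (t₀ + l) (t₀ + 2 * l) = G)) with he | ⟨X₀, hX₀⟩
    · rw [he]; simp
    · rw [Finset.mem_filter] at hX₀
      obtain ⟨-, h0lo, h0hi, h0G⟩ := hX₀
      refine le_trans ?_ (hy (lo * y / q ^ t₀ + q ^ l * hi * y)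
        ((X₀ : ℕ) * y / q ^ (t₀ + l) % q ^ l))
      apply Finset.card_le_card_of_injOn (fun X : Fin (q ^ n) => (X : ℕ) / q ^ t₀ % q ^ l)
      · intro X hX
        simp only [Finset.coe_filter, Finset.mem_univ, true_and, Set.mem_ofPred_eq] at hX
        obtain ⟨hlo, hhi, hG⟩ := hX
        simp only [Finset.coe_filter, Finset.mem_range, Set.mem_ofPred_eq]
        refine ⟨?_, ?_⟩
        · rw [← hqL]; exact Nat.mod_lt _ (by positivity)
        · rw [← hqL]
          have h1 := mul_div_pow_eq (q := q) X y t₀ l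
          rw [hlo, hhi] at h1
          rw [← h1]
          apply div_mod_eq_of_digit_eq
          intro i hi
          rw [← hA X (t₀ + l + i) (by omega), ← hA X₀ (t₀ + l + i) (by omega)]
          refine A.outputAt_eq_of_transferGraph_eq (t₀ := t₀) (t₁ := t₀ + l) (t₂ := t₀ + 2 * l)
            (by omega) ?_ ?_ (hG.trans h0G.symm) (by omega) (by omega)
          · exact fun t ht => digit_eq_of_mod_eq (hlo.trans h0lo.symm) ht
          · exact fun t ht _ => digit_eq_of_div_eq (hhi.trans h0hi.symm) ht
      · intro X hX X' hX' heq
        simp only [Finset.coe_filter, Finset.mem_univ, true_and, Set.mem_ofPred_eq] at hX hX'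
        apply Fin.ext
        rw [eq_low_add_mid_add_high q X t₀ l, eq_low_add_mid_add_high q X' t₀ l,
          hX.1, hX.2.1, hX'.1, hX'.2.1]
        simp only at heq
        rw [heq]
  set small := (Finset.univ : Finset (Fin (q ^ n))).filter (fun X : Fin (q ^ n) =>
      (A.transfer (digits q X) t₀ (t₀ + l) (t₀ + 2 * l)).card ≤ k) with hsmall
  have hfib : ∀ b ∈ Finset.range (q ^ t₀) ×ˢ Finset.range (q ^ (n - (t₀ + l))),
      (small.filter (fun X : Fin (q ^ n) =>
        ((X : ℕ) % q ^ t₀, (X : ℕ) / q ^ (t₀ + l)) = b)).card ≤ 2 ^ (L - 1) := by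
    rintro ⟨lo, hi⟩ -
    refine le_trans ?_ hgraph
    refine le_trans ?_ (Nat.mul_le_mul_right _ (card_transferGraphs_le hw k))
    rw [mul_comm]
    refine Finset.card_le_mul_card_image_of_maps_to
      (f := fun X : Fin (q ^ n) => A.transferGraph (digits q X) t₀ (t₀ + l) (t₀ + 2 * l)) ?_ _ ?_
    · intro X hX
      simp only [hsmall, Finset.mem_filter, Finset.mem_univ, true_and] at hX ⊢
      rw [Algorithm.card_transferGraph]
      exact hX.1
    · intro G _
      refine le_trans (Finset.card_le_card ?_) (hsame lo hi G)
      intro X hX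
      simp only [Finset.mem_filter, Finset.mem_univ, true_and, Prod.mk.injEq] at hX ⊢
      exact ⟨hX.1.2.1, hX.1.2.2, hX.2⟩
  have hmain := Finset.card_le_mul_card_image_of_maps_to (s := small)
    (f := fun X : Fin (q ^ n) => ((X : ℕ) % q ^ t₀, (X : ℕ) / q ^ (t₀ + l))) (by
      intro X _
      simp only [Finset.mem_product, Finset.mem_range]
      refine ⟨Nat.mod_lt _ (by positivity), ?_⟩
      rw [Nat.div_lt_iff_lt_mul (by positivity), ← pow_add]
      have : n - (t₀ + l) + (t₀ + l) = n := by omega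
      rw [this]
      exact X.2) _ hfib
  rw [Finset.card_product, Finset.card_range, Finset.card_range] at hmain
  calc 2 * small.card ≤ 2 * (2 ^ (L - 1) * (q ^ t₀ * q ^ (n - (t₀ + l)))) :=
        Nat.mul_le_mul_left 2 hmain
    _ = 2 ^ L * (q ^ t₀ * q ^ (n - (t₀ + l))) := by
        rw [← mul_assoc, ← pow_succ']
        congr 2
        omega
    _ = q ^ n := by
        rw [← hqL, ← pow_add, ← pow_add]
        congr 1
        omega

/-- At least half of all `X` transfer `k + 1` or more cells. The constant is `48 = 2 * 8 * 3`: half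
of the inputs, `L / 8` bits, `3 * w` bits per cell. -/
theorem sum_card_transfer_ge (hδ : 0 < δ) (hw : 0 < w) {y t₀ l : ℕ} (hl : 0 < l)
    (hn : t₀ + 2 * l ≤ n) {A : Algorithm w (Fin (2 ^ δ)) (Fin (2 ^ δ))}
    (hA : SolvesMulBy (2 ^ δ) n y A) (hy : Spreads (δ * l) y) :
    δ * l * (2 ^ δ) ^ n ≤ 48 * w * ∑ X : Fin ((2 ^ δ) ^ n),
      (A.transfer (digits (2 ^ δ) X) t₀ (t₀ + l) (t₀ + 2 * l)).card := by
  have hsmall := two_mul_card_small_transfer_le rfl hδ hw hl hn hA hy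
  set k := ((δ * l + 7) / 8 - 1) / (3 * w) with hk
  set N := (2 ^ δ) ^ n with hN
  set c : Fin N → ℕ := fun X =>
    (A.transfer (digits (2 ^ δ) X) t₀ (t₀ + l) (t₀ + 2 * l)).card with hc
  change 2 * ((Finset.univ : Finset (Fin N)).filter (fun X => c X ≤ k)).card ≤ N at hsmall
  have hsplit := Finset.card_filter_add_card_filter_not
    (s := (Finset.univ : Finset (Fin N))) (fun X => c X ≤ k)
  rw [Finset.card_univ, Fintype.card_fin] at hsplit
  have hlarge : (k + 1) * ((Finset.univ : Finset (Fin N)).filter (fun X => ¬ c X ≤ k)).card ≤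
      ∑ X, c X := by
    rw [mul_comm, ← smul_eq_mul]
    refine (Finset.card_nsmul_le_sum _ c (k + 1) fun X hX => ?_).trans
      (Finset.sum_le_sum_of_subset (Finset.subset_univ _))
    rw [Finset.mem_filter] at hX
    omega
  have hk2 : δ * l ≤ 24 * w * (k + 1) := by
    have h1 := Nat.lt_mul_div_succ ((δ * l + 7) / 8 - 1) (show 0 < 3 * w by omega)
    rw [← hk] at h1
    have h2 : 24 * w * (k + 1) = 8 * (3 * w * (k + 1)) := by ring
    omega
  calc δ * l * N ≤ 24 * w * (k + 1) * (2 *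
        ((Finset.univ : Finset (Fin N)).filter (fun X => ¬ c X ≤ k)).card) :=
        Nat.mul_le_mul hk2 (by omega)
    _ = 48 * w * ((k + 1) *
        ((Finset.univ : Finset (Fin N)).filter (fun X => ¬ c X ≤ k)).card) := by ring
    _ ≤ _ := Nat.mul_le_mul_left _ hlarge

/-! ### Summation over the nodes and averaging over multipliers -/

open Classical in
theorem sum_time_ge (hδ : 0 < δ) (hw : 0 < w) {y : ℕ}
    {A : Algorithm w (Fin (2 ^ δ)) (Fin (2 ^ δ))} (hA : SolvesMulBy (2 ^ δ) n y A) :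
    (∑ v ∈ dyadicNodes n, if Spreads (δ * 2 ^ v.1) y then δ * 2 ^ v.1 else 0) * (2 ^ δ) ^ n ≤
      48 * w * ∑ X : Fin ((2 ^ δ) ^ n), A.time (digits (2 ^ δ) X) n := by
  calc _ ≤ ∑ v ∈ dyadicNodes n, 48 * w * ∑ X : Fin ((2 ^ δ) ^ n),
        (A.nodeTransfer (digits (2 ^ δ) X) v).card := by
        rw [Finset.sum_mul]
        refine Finset.sum_le_sum fun v hv => ?_
        split_ifs with h
        · exact sum_card_transfer_ge hδ hw (by positivity) (dyadicNodes_bound hv) hA h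
        · simp
    _ = 48 * w * ∑ X : Fin ((2 ^ δ) ^ n), ∑ v ∈ dyadicNodes n,
        (A.nodeTransfer (digits (2 ^ δ) X) v).card := by
        rw [← Finset.mul_sum, Finset.sum_comm]
    _ ≤ _ := Nat.mul_le_mul_left _
        (Finset.sum_le_sum fun X _ => A.sum_card_nodeTransfer_le _ n)

/-- Every level gives at least `n / 4`: its half-lengths total `2 ^ j * (n / 2 ^ (j + 1))`, and
rounding down a quotient that is at least `1` loses less than a factor of two. -/
theorem sum_dyadicNodes_ge (n : ℕ) :
    n * Nat.log 2 n ≤ 4 * ∑ v ∈ dyadicNodes n, 2 ^ v.1 := by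
  rw [dyadicNodes, Finset.sum_sigma, Finset.mul_sum]
  calc n * Nat.log 2 n = ∑ _j ∈ Finset.range (Nat.log 2 n), n := by simp [mul_comm]
    _ ≤ _ := by
      refine Finset.sum_le_sum fun j hj => ?_
      rw [Finset.mem_range] at hj
      simp only [Finset.sum_const, Finset.card_range, smul_eq_mul]
      have hn : n ≠ 0 := by rintro rfl; simp at hj
      have h1 : 2 ^ (j + 1) ≤ n := Nat.pow_le_of_le_log hn hj
      have h2 : 1 ≤ n / 2 ^ (j + 1) := (Nat.one_le_div_iff (by positivity)).mpr h1
      have h3 := Nat.lt_mul_div_succ n (show 0 < 2 ^ (j + 1) by positivity)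
      rw [pow_succ] at *
      nlinarith [Nat.mul_le_mul_left (2 ^ j) h2]

theorem sum_time_ge_of_forall_spreads (hδ : 0 < δ) (hw : 0 < w) {y : ℕ}
    (hy : ∀ v ∈ dyadicNodes n, Spreads (δ * 2 ^ v.1) y)
    {A : Algorithm w (Fin (2 ^ δ)) (Fin (2 ^ δ))} (hA : SolvesMulBy (2 ^ δ) n y A) :
    δ * (n * Nat.log 2 n) * (2 ^ δ) ^ n ≤
      192 * w * ∑ X : Fin ((2 ^ δ) ^ n), A.time (digits (2 ^ δ) X) n := by
  classical
  have h := sum_time_ge hδ hw hA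
  rw [Finset.sum_congr rfl fun v hv => if_pos (hy v hv), ← Finset.mul_sum] at h
  calc _ ≤ δ * (4 * ∑ v ∈ dyadicNodes n, 2 ^ v.1) * (2 ^ δ) ^ n := by
        exact Nat.mul_le_mul_right _ (Nat.mul_le_mul_left δ (sum_dyadicNodes_ge n))
    _ = 4 * ((δ * ∑ v ∈ dyadicNodes n, 2 ^ v.1) * (2 ^ δ) ^ n) := by ring
    _ ≤ 4 * (48 * w * ∑ X : Fin ((2 ^ δ) ^ n), A.time (digits (2 ^ δ) X) n) :=
        Nat.mul_le_mul_left 4 h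
    _ = _ := by ring

/-- No single `Y` has to spread at all nodes: the sums over `Y` and over nodes are exchanged, and
each node keeps a quarter of its weight. Hence `768 = 4 * 4 * 48`. -/
theorem sum_sum_time_ge (hδ : 0 < δ) (hw : 0 < w)
    {A : Fin ((2 ^ δ) ^ n) → Algorithm w (Fin (2 ^ δ)) (Fin (2 ^ δ))}
    (hA : ∀ Y : Fin ((2 ^ δ) ^ n), SolvesMulBy (2 ^ δ) n Y (A Y)) :
    δ * (n * Nat.log 2 n) * ((2 ^ δ) ^ n * (2 ^ δ) ^ n) ≤
      768 * w * ∑ Y : Fin ((2 ^ δ) ^ n), ∑ X : Fin ((2 ^ δ) ^ n),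
        (A Y).time (digits (2 ^ δ) X) n := by
  classical
  have hcount : ∀ v ∈ dyadicNodes n, δ * 2 ^ v.1 * (2 ^ δ) ^ n ≤
      4 * ∑ Y : Fin ((2 ^ δ) ^ n), if Spreads (δ * 2 ^ v.1) Y then δ * 2 ^ v.1 else 0 := by
    intro v hv
    rw [← Finset.sum_filter, Finset.sum_const, smul_eq_mul]
    have hb := dyadicNodes_bound hv
    have h1 : δ * 2 ^ v.1 + δ * 2 ^ v.1 ≤ δ * n := by
      rw [← mul_add]; exact Nat.mul_le_mul_left δ (by omega)
    have h2 := card_spreads_ge (Nat.mul_pos hδ (Nat.two_pow_pos v.1)) h1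
    rw [pow_mul] at h2
    calc _ ≤ δ * 2 ^ v.1 * (4 * _) := Nat.mul_le_mul_left _ h2
      _ = _ := by ring
  have hall : δ * (n * Nat.log 2 n) * (2 ^ δ) ^ n ≤ 16 * ∑ Y : Fin ((2 ^ δ) ^ n),
      ∑ v ∈ dyadicNodes n, if Spreads (δ * 2 ^ v.1) Y then δ * 2 ^ v.1 else 0 := by
    calc _ ≤ δ * (4 * ∑ v ∈ dyadicNodes n, 2 ^ v.1) * (2 ^ δ) ^ n := by
          exact Nat.mul_le_mul_right _ (Nat.mul_le_mul_left δ (sum_dyadicNodes_ge n))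
      _ = 4 * ∑ v ∈ dyadicNodes n, δ * 2 ^ v.1 * (2 ^ δ) ^ n := by
          rw [← Finset.sum_mul, ← Finset.mul_sum]; ring
      _ ≤ 4 * ∑ v ∈ dyadicNodes n, 4 * ∑ Y : Fin ((2 ^ δ) ^ n),
            if Spreads (δ * 2 ^ v.1) Y then δ * 2 ^ v.1 else 0 :=
          Nat.mul_le_mul_left 4 (Finset.sum_le_sum hcount)
      _ = _ := by
          rw [← Finset.mul_sum, Finset.sum_comm, ← mul_assoc]
          norm_num
  calc _ = δ * (n * Nat.log 2 n) * (2 ^ δ) ^ n * (2 ^ δ) ^ n := by ring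
    _ ≤ _ := Nat.mul_le_mul_right _ hall
    _ = 16 * ∑ Y : Fin ((2 ^ δ) ^ n), (∑ v ∈ dyadicNodes n,
          if Spreads (δ * 2 ^ v.1) Y then δ * 2 ^ v.1 else 0) * (2 ^ δ) ^ n := by
        rw [← Finset.sum_mul]; ring
    _ ≤ 16 * ∑ Y : Fin ((2 ^ δ) ^ n), 48 * w * ∑ X : Fin ((2 ^ δ) ^ n),
          (A Y).time (digits (2 ^ δ) X) n :=
        Nat.mul_le_mul_left 16 (Finset.sum_le_sum fun Y _ => sum_time_ge hδ hw (hA Y))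
    _ = _ := by rw [← Finset.mul_sum]; ring

/-- The algorithm that receives the second input of a pair in advance. -/
def Algorithm.hardwire {In In' Out : Type} (A : Algorithm w (In × In') Out) (y : ℕ → In') :
    Algorithm w In Out where
  init := A.init
  step t x := A.step t (x, y t)

section Hardwire

variable {In In' Out : Type} (A : Algorithm w (In × In') Out) (y : ℕ → In')

theorem Algorithm.memoryAt_hardwire (x : ℕ → In) (t : ℕ) :
    (A.hardwire y).memoryAt x t = A.memoryAt (fun t => (x t, y t)) t := by
  induction t with
  | zero => rfl
  | succ t ih =>
    simp only [Algorithm.memoryAt, ih]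
    rfl

theorem Algorithm.outputAt_hardwire (x : ℕ → In) (t : ℕ) :
    (A.hardwire y).outputAt x t = A.outputAt (fun t => (x t, y t)) t := by
  simp only [Algorithm.outputAt, Algorithm.memoryAt_hardwire]
  rfl

theorem Algorithm.time_hardwire (x : ℕ → In) (n : ℕ) :
    (A.hardwire y).time x n = A.time (fun t => (x t, y t)) n := by
  simp only [Algorithm.time, Algorithm.memoryAt_hardwire]
  rfl

end Hardwire

theorem log_le_two_mul_natLog {n : ℕ} (hn : 0 < n) : Real.log n ≤ 2 * Nat.log 2 n := by
  have hn' : (0 : ℝ) < n := by exact_mod_cast hn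
  rcases Nat.lt_or_ge n 2 with h | h
  · have : n = 1 := by omega
    subst this; simp
  have h1 : 1 ≤ Nat.log 2 n := Nat.log_pos (by norm_num) h
  have h2 : (n : ℝ) ≤ 2 ^ (Nat.log 2 n + 1) := by
    exact_mod_cast (Nat.lt_pow_succ_log_self (by norm_num : 1 < 2) n).le
  have h3 := Real.log_le_log hn' h2
  rw [Real.log_pow] at h3
  have h4 : Real.log 2 ≤ 1 := by linarith [Real.log_two_lt_d9]
  have h5 : (1 : ℝ) ≤ Nat.log 2 n := by exact_mod_cast h1
  push_cast at h3
  nlinarith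

/-- `1536 = 2 * 768`, with the factor `2` from `log_le_two_mul_natLog`; `768` covers both averaged
bounds. -/
theorem real_bound_of_nat_bound (hn : 0 < n) (hw : 0 < w) {C N T : ℕ} (hN : 0 < N)
    (hC' : C ≤ 768) (h : δ * (n * Nat.log 2 n) * N ≤ C * w * T) :
    1 / 1536 * ((δ : ℝ) / w * (n * Real.log n)) ≤ (T : ℝ) / N := by
  have hN' : (0 : ℝ) < N := by exact_mod_cast hN
  have hw' : (0 : ℝ) < w := by exact_mod_cast hw
  have h' : (δ : ℝ) * (n * Nat.log 2 n) * N ≤ C * w * T := by exact_mod_cast h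
  have hCr : (C : ℝ) ≤ 768 := by exact_mod_cast hC'
  have h2 : (C : ℝ) * w * T ≤ 768 * w * T := by gcongr
  have h3 : (δ : ℝ) * (n * Real.log n) ≤ δ * (n * (2 * Nat.log 2 n)) := by
    gcongr; exact log_le_two_mul_natLog hn
  have h4 := mul_le_mul_of_nonneg_right h3 hN'.le
  rw [le_div_iff₀ hN']
  have h5 : 1 / 1536 * ((δ : ℝ) / w * (n * Real.log n)) * N =
      (δ * (n * Real.log n) * N) / (1536 * w) := by field_simp
  rw [h5, div_le_iff₀ (by positivity)]
  linarith

end CellProbe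

theorem theorem3 :
    ∃ c : ℝ, 0 < c ∧ ∀ δ n w : ℕ, 0 < δ → 0 < n → 0 < w →
      -- both numbers are random and arrive online
      (∀ A : CellProbe.Algorithm w (Fin (2 ^ δ) × Fin (2 ^ δ)) (Fin (2 ^ δ)),
        CellProbe.SolvesMul (2 ^ δ) n A →
        c * ((δ : ℝ) / w * (n * Real.log n)) ≤
          𝔼 X : Fin ((2 ^ δ) ^ n), 𝔼 Y : Fin ((2 ^ δ) ^ n),
            (A.time (CellProbe.digitPairs (2 ^ δ) X Y) n : ℝ)) ∧
      -- both numbers are random, and the algorithm has full access to `Y` at all times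
      (∀ A : Fin ((2 ^ δ) ^ n) → CellProbe.Algorithm w (Fin (2 ^ δ)) (Fin (2 ^ δ)),
        (∀ Y : Fin ((2 ^ δ) ^ n), CellProbe.SolvesMulBy (2 ^ δ) n Y (A Y)) →
        c * ((δ : ℝ) / w * (n * Real.log n)) ≤
          𝔼 X : Fin ((2 ^ δ) ^ n), 𝔼 Y : Fin ((2 ^ δ) ^ n),
            ((A Y).time (CellProbe.digits (2 ^ δ) X) n : ℝ)) ∧
      -- `X` is random, and `Y = K_{q,n}` is fixed
      (∀ A : CellProbe.Algorithm w (Fin (2 ^ δ)) (Fin (2 ^ δ)),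
        CellProbe.SolvesMulBy (2 ^ δ) n (CellProbe.K δ n) A →
        c * ((δ : ℝ) / w * (n * Real.log n)) ≤
          𝔼 X : Fin ((2 ^ δ) ^ n), (A.time (CellProbe.digits (2 ^ δ) X) n : ℝ)) := by
  refine ⟨1 / 1536, by norm_num, fun δ n w hδ hn hw => ?_⟩
  have hN : 0 < (2 ^ δ) ^ n := by positivity
  have access : ∀ A : Fin ((2 ^ δ) ^ n) → CellProbe.Algorithm w (Fin (2 ^ δ)) (Fin (2 ^ δ)),
      (∀ Y : Fin ((2 ^ δ) ^ n), CellProbe.SolvesMulBy (2 ^ δ) n Y (A Y)) →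
      1 / 1536 * ((δ : ℝ) / w * (n * Real.log n)) ≤
        𝔼 X : Fin ((2 ^ δ) ^ n), 𝔼 Y : Fin ((2 ^ δ) ^ n),
          ((A Y).time (CellProbe.digits (2 ^ δ) X) n : ℝ) := by
    intro A hA
    have h := CellProbe.real_bound_of_nat_bound hn hw (Nat.mul_pos hN hN) le_rfl
      (CellProbe.sum_sum_time_ge hδ hw hA)
    rw [Finset.expect_comm]
    refine h.trans_eq ?_
    simp only [Fintype.expect_eq_sum_div_card, Fintype.card_fin]
    rw [← Finset.sum_div, div_div]
    push_cast
    rfl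
  refine ⟨fun A hA => ?_, access, fun A hA => ?_⟩
  -- Advance knowledge of `Y` only helps: hardwiring its digits turns the online algorithm into one
  -- for each fixed `Y`, with the same probes.
  · have h := access (fun Y => A.hardwire (CellProbe.digits (2 ^ δ) Y)) (fun Y X i hi => by
      rw [CellProbe.Algorithm.outputAt_hardwire]
      exact hA X Y i hi)
    simp only [CellProbe.Algorithm.time_hardwire] at h
    exact h
  · have hs : ∀ v ∈ CellProbe.dyadicNodes n,
        CellProbe.Spreads (δ * 2 ^ v.1) (CellProbe.K δ n) := by
      intro v hv
      have hb := CellProbe.dyadicNodes_bound hv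
      refine CellProbe.spreads_K (Nat.mul_pos hδ (Nat.two_pow_pos v.1)) ?_
      rw [← mul_add]
      exact Nat.mul_le_mul_left δ (by omega)
    have h := CellProbe.real_bound_of_nat_bound hn hw hN (by norm_num)
      (CellProbe.sum_time_ge_of_forall_spreads hδ hw hs hA)
    refine h.trans_eq ?_
    rw [Fintype.expect_eq_sum_div_card, Fintype.card_fin]
    push_cast
    rfl
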